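/- Let $\mathfrak{N}_1$ and $\mathfrak{N}_2$ be properly infinite von Neumann algebras on a complex Hilbert space $\mathcal{H}$ (that is, every nonzero central projection of $\mathfrak{N}_i$ is infinite relative to $\mathfrak{N}_i$) such that $\mathfrak{N}_1 \subseteq \mathfrak{N}_2'$, where $\mathfrak{N}_2'$ is the commutant of $\mathfrak{N}_2$, and such that $X_1X_2 \neq 0$ for all nonzero operators $X_1 \in \mathfrak{N}_1$ and $X_2 \in \mathfrak{N}_2$. Let $\mathfrak{N}_1 \vee \mathfrak{N}_2$ be the von Neumann algebra generated by $\mathfrak{N}_1$ and $\mathfrak{N}_2$. A state $\omega$ of $\mathfrak{N}_1 \vee \mathfrak{N}_2$ is called Bell correlated if there are self-adjoint contractions $A_1, B_1 \in \mathfrak{N}_1$ and $A_2, B_2 \in \mathfrak{N}_2$ (self-adjoint operators $X$ with $-I \leq X \leq I$) such that \[ \frac{1}{2} \left| \omega(A_1A_2 + A_1B_2 + B_1A_2 - B_1B_2) \right| > 1. \] Then for every unit vector $\Psi \in \mathcal{H}$ and every real number $\epsilon > 0$ there exists a unit vector $\Psi' \in \mathcal{H}$ such that $\|\Psi - \Psi'\|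 < \epsilon$ and the vector state $X \mapsto \langle \Psi', X\Psi' \rangle$ of $\mathfrak{N}_1 \vee \mathfrak{N}_2$ induced by $\Psi'$ is Bell correlated. -/

import Mathlib

open scoped ComplexOrder InnerProductSpace

namespace VonNeumannAlgebra

variable {H : Type*} [NormedAddCommGroup H] [InnerProductSpace ℂ H] [CompleteSpace H]

/-- Murray–von Neumann equivalence of `p` and `q` relative to the von Neumann algebra `N`. -/
def MvNEquiv (N : VonNeumannAlgebra H) (p q : H →L[ℂ] H) : Prop :=
  ∃ v ∈ N, star v * v = p ∧ v * star v = q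

/-- A projection `p` of `N` is finite (relative to `N`) if the only projection of `N` below `p` that
is equivalent to `p` in `N` is `p` itself. -/
def IsFiniteProj (N : VonNeumannAlgebra H) (p : H →L[ℂ] H) : Prop :=
  ∀ q ∈ N, IsStarProjection q → q ≤ p → N.MvNEquiv p q → q = p

/-- `N` is properly infinite if every nonzero central projection of `N` is infinite
(that is, not finite) relative to `N`. -/
def ProperlyInfinite (N : VonNeumannAlgebra H) : Prop :=
  ∀ z ∈ N, z ∈ N.commutant → IsStarProjection z → z ≠ 0 → ¬ N.IsFiniteProj z

/-- The von Neumann algebra generated by a set of bounded operators: the double commutant of the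
set together with the adjoints of its elements. -/
noncomputable def generatedBy (S : Set (H →L[ℂ] H)) : VonNeumannAlgebra H where
  toStarSubalgebra :=
    StarSubalgebra.centralizer ℂ (StarSubalgebra.centralizer ℂ S : Set (H →L[ℂ] H))
  centralizer_centralizer' := by
    change Set.centralizer (Set.centralizer (Set.centralizer _)) = Set.centralizer _
    exact Set.centralizer_centralizer_centralizer _

theorem subset_generatedBy (S : Set (H →L[ℂ] H)) :
    S ⊆ (generatedBy S : Set (H →L[ℂ] H)) := by
  intro x hx
  change x ∈ StarSubalgebra.centralizer ℂ (StarSubalgebra.centralizer ℂ S : Set (H →L[ℂ] H))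
  rw [StarSubalgebra.mem_centralizer_iff]
  intro g hg
  have h1 := StarSubalgebra.mem_centralizer_iff ℂ |>.1 hg x hx
  have h2 := StarSubalgebra.mem_centralizer_iff ℂ |>.1 (star_mem hg) x hx
  exact ⟨h1.1.symm, h2.1.symm⟩

/-- The von Neumann algebra `N₁ ∨ N₂` generated by `N₁` and `N₂`. -/
noncomputable def join (N₁ N₂ : VonNeumannAlgebra H) : VonNeumannAlgebra H :=
  generatedBy ((N₁ : Set (H →L[ℂ] H)) ∪ (N₂ : Set (H →L[ℂ] H)))

/-- `N₁ ∨ N₂` is the double commutant of the union of `N₁` and `N₂`. -/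
theorem coe_join (N₁ N₂ : VonNeumannAlgebra H) :
    (N₁.join N₂ : Set (H →L[ℂ] H)) = Set.centralizer (Set.centralizer
      ((N₁ : Set (H →L[ℂ] H)) ∪ (N₂ : Set (H →L[ℂ] H)))) := by
  have hs : star ((N₁ : Set (H →L[ℂ] H)) ∪ (N₂ : Set (H →L[ℂ] H))) =
      (N₁ : Set (H →L[ℂ] H)) ∪ (N₂ : Set (H →L[ℂ] H)) := by
    ext x; simp
  change (StarSubalgebra.centralizer ℂ (StarSubalgebra.centralizer ℂ
    ((N₁ : Set (H →L[ℂ] H)) ∪ (N₂ : Set (H →L[ℂ] H))) : Set (H →L[ℂ] H)) : Set (H →L[ℂ] H)) = _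
  rw [StarSubalgebra.coe_centralizer_centralizer, hs, Set.union_self]

theorem mem_join_left {N₁ N₂ : VonNeumannAlgebra H} {x : H →L[ℂ] H} (hx : x ∈ N₁) :
    x ∈ N₁.join N₂ := subset_generatedBy _ (Or.inl hx)

theorem mem_join_right {N₁ N₂ : VonNeumannAlgebra H} {x : H →L[ℂ] H} (hx : x ∈ N₂) :
    x ∈ N₁.join N₂ := subset_generatedBy _ (Or.inr hx)

/-- The inclusion of `N₁` into `N₁ ∨ N₂`. -/
noncomputable def inl (N₁ N₂ : VonNeumannAlgebra H) (x : N₁) : (N₁.join N₂).toStarSubalgebra :=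
  ⟨x, mem_join_left x.2⟩

/-- The inclusion of `N₂` into `N₁ ∨ N₂`. -/
noncomputable def inr (N₁ N₂ : VonNeumannAlgebra H) (x : N₂) : (N₁.join N₂).toStarSubalgebra :=
  ⟨x, mem_join_right x.2⟩

/-- A state of a von Neumann algebra: a positive linear functional with value `1` at the identity
operator. -/
structure State (N : VonNeumannAlgebra H) where
  /-- the underlying linear functional -/
  toLinearMap : N.toStarSubalgebra →ₗ[ℂ] ℂ
  nonneg : ∀ x : N.toStarSubalgebra, 0 ≤ (x : H →L[ℂ] H) → 0 ≤ toLinearMap x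
  map_one : toLinearMap 1 = 1

/-- The vector state `x ↦ ⟨Ψ, x Ψ⟩` of `N` induced by a unit vector `Ψ`. -/
noncomputable def vectorState (N : VonNeumannAlgebra H) (Ψ : H) (hΨ : ‖Ψ‖ = 1) : N.State where
  toLinearMap :=
    { toFun := fun x => ⟪Ψ, (x : H →L[ℂ] H) Ψ⟫_ℂ
      map_add' := fun x y => by simp
      map_smul' := fun c x => by simp }
  nonneg := fun x hx =>
    ((ContinuousLinearMap.nonneg_iff_isPositive _).1 hx).inner_nonneg_right Ψ
  map_one := by simp [inner_self_eq_norm_sq_to_K, hΨ]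

/-- A self-adjoint contraction: a self-adjoint operator `X` with `-I ≤ X ≤ I`. -/
def IsSelfAdjointContraction (X : H →L[ℂ] H) : Prop :=
  IsSelfAdjoint X ∧ -1 ≤ X ∧ X ≤ 1

/-- A state `ω` of `N₁ ∨ N₂` is Bell correlated if it violates a Bell (CHSH) inequality for
some self-adjoint contractions `A₁, B₁ ∈ N₁` and `A₂, B₂ ∈ N₂`. -/
def BellCorrelated (N₁ N₂ : VonNeumannAlgebra H) (ω : (N₁.join N₂).State) : Prop :=
  ∃ (A₁ B₁ : N₁) (A₂ B₂ : N₂),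
    IsSelfAdjointContraction (A₁ : H →L[ℂ] H) ∧ IsSelfAdjointContraction (B₁ : H →L[ℂ] H) ∧
    IsSelfAdjointContraction (A₂ : H →L[ℂ] H) ∧ IsSelfAdjointContraction (B₂ : H →L[ℂ] H) ∧
    1 < (1 / 2 : ℝ) * ‖ω.toLinearMap
      (inl N₁ N₂ A₁ * inr N₁ N₂ A₂ + inl N₁ N₂ A₁ * inr N₁ N₂ B₂
        + inl N₁ N₂ B₁ * inr N₁ N₂ A₂ - inl N₁ N₂ B₁ * inr N₁ N₂ B₂)‖

end VonNeumannAlgebra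

namespace VonNeumannAlgebra

/-! ### Square-zero partial isometries in a star ring -/

section Algebra

variable {R : Type*} [Ring R] [StarRing R]

/-! Proper infiniteness puts a non-unitary isometry `v` in each algebra. Moving a copy of a 2×2
matrix corner far along its powers gives a square-zero partial isometry `V` whose support almost
annihilates `Ψ` (`ProperlyInfinite.exists_sq_zero`). Take such `V` and `W` in the two algebras. Off
these supports all four observables are the identity, so `φ = P₁ (P₂ Ψ)`, which is close to `Ψ`, has
CHSH value 2, exactly the classical bound. On the product of the corners, nonzero by the product
hypothesis, they act as Pauli matrices, and a maximally entangled `θ` gives `2√2`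
(`exists_entangled`). The CHSH operator has no cross terms between `φ` and `θ` (`chsh_apply`), so
adding any nonzero multiple of `θ`, however small, pushes the expectation above 2
(`two_lt_expectation`). -/

/-- An isometry pushes its cokernel projection to square-zero partial isometries whose supports
telescope. -/
theorem exists_sq_zero_of_isometry {v : R} (hv : star v * v = 1) (hv' : v * star v ≠ 1) (n : ℕ) :
    let V := v ^ n * (v * (1 - v * star v)) * star (v ^ n)
    V * V = 0 ∧ V * star V * V = V ∧ V ≠ 0 ∧
      star V * V + V * star V = v ^ n * (1 - v * v * star (v * v)) * star (v ^ n) := by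
  intro V
  have hn : star (v ^ n) * v ^ n = 1 := by
    induction n with
    | zero => simp
    | succ k ih =>
      rw [pow_succ', star_mul, mul_assoc, ← mul_assoc (star v), hv, one_mul, ih]
  have hn' : ∀ x, star (v ^ n) * (v ^ n * x) = x := fun x => by rw [← mul_assoc, hn, one_mul]
  have hv1 : ∀ x, star v * (v * x) = x := fun x => by rw [← mul_assoc, hv, one_mul]
  have hstar : star V = v ^ n * ((1 - v * star v) * star v) * star (v ^ n) := by
    simp only [V, star_mul, star_sub, star_star, star_one, mul_assoc]
  refine ⟨?_, ?_, ?_, ?_⟩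
  · simp only [V, mul_assoc, hn', sub_mul, mul_sub, mul_one, hv1]
    noncomm_ring
  · rw [hstar]
    simp only [V, mul_assoc, hn', sub_mul, mul_sub, one_mul, mul_one, hv1]
    noncomm_ring
  · intro h0
    apply hv'
    -- Undoing the shift by `v ^ n`, then cancelling `v`, recovers `1 - v * star v`.
    have h1 : star (v ^ n) * V * v ^ n = v * (1 - v * star v) := by
      simp only [V, mul_assoc, hn', hn, mul_one]
    rw [h0, mul_zero, zero_mul] at h1
    have h2 := congrArg (star v * ·) h1
    simp only [hv1, mul_zero] at h2
    exact (sub_eq_zero.1 h2.symm).symm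
  · rw [hstar]
    simp only [V, mul_assoc, hn', sub_mul, mul_sub, one_mul, mul_one, hv1, star_mul]
    noncomm_ring

/-- The algebraic relations between the Pauli-type operators attached to a square-zero partial
isometry `V`. -/
theorem pauli_relations {V : R} (h0 : V * V = 0) (h1 : V * star V * V = V) :
    let P := 1 - (star V * V + V * star V)
    let X := V + star V
    let Z := star V * V - V * star V
    P * P = P ∧ P * X = 0 ∧ X * P = 0 ∧ P * Z = 0 ∧ Z * P = 0 ∧
      X * X = 1 - P ∧ Z * Z = 1 - P ∧ X * Z + Z * X = 0 := by
  intro P X Z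
  have h0s : star V * star V = 0 := by rw [← star_mul, h0, star_zero]
  have h1s : star V * (V * star V) = star V := by
    have := congrArg star h1
    simpa only [star_mul, star_star] using this
  have h1' : V * (star V * V) = V := by rw [← mul_assoc, h1]
  have h0r : ∀ x, V * (V * x) = 0 := fun x => by rw [← mul_assoc, h0, zero_mul]
  have h0sr : ∀ x, star V * (star V * x) = 0 := fun x => by rw [← mul_assoc, h0s, zero_mul]
  refine ⟨?_, ?_, ?_, ?_, ?_, ?_, ?_, ?_⟩ <;>
  · simp only [P, X, Z, mul_sub, sub_mul, mul_add, add_mul, one_mul, mul_one, mul_assoc, h0, h0s,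
      h1s, h1', h0r, h0sr, mul_zero]
    abel

end Algebra

/-! ### Vector estimates for the CHSH operator -/

variable {H : Type*} [NormedAddCommGroup H] [InnerProductSpace ℂ H]

/-- The CHSH operator fixes twice the vectors in the range of `P₁ * P₂` and expands maximally
entangled vectors by the Tsirelson bound. -/
theorem chsh_apply {P₁ X₁ Z₁ P₂ X₂ Z₂ : H →L[ℂ] H} {φ θ : H} (c : ℂ)
    (hφ₁ : P₁ φ = φ) (hφ₂ : P₂ φ = φ) (hθ₁ : P₁ θ = 0) (hθ₂ : P₂ θ = 0)
    (hX₁ : X₁ * P₁ = 0) (hZ₁ : Z₁ * P₁ = 0) (hX₂ : X₂ * P₂ = 0) (hZ₂ : Z₂ * P₂ = 0)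
    (hPX : P₁ * X₂ = X₂ * P₁) (hPZ : P₁ * Z₂ = Z₂ * P₁)
    (hXX : X₁ (X₂ θ) = θ) (hZZ : Z₁ (Z₂ θ) = θ) :
    ((P₁ + X₁) * (P₂ + c • (X₂ + Z₂)) + (P₁ + X₁) * (P₂ + c • (X₂ - Z₂)) +
      (P₁ + Z₁) * (P₂ + c • (X₂ + Z₂)) - (P₁ + Z₁) * (P₂ + c • (X₂ - Z₂))) (φ + θ) =
      (2 : ℂ) • φ + (4 * c) • θ := by
  have ap : ∀ {S T : H →L[ℂ] H}, S = T → ∀ y, S y = T y := fun h y => by rw [h]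
  have f1 : X₁ φ = 0 := by rw [← hφ₁]; exact ap hX₁ φ
  have f2 : Z₁ φ = 0 := by rw [← hφ₁]; exact ap hZ₁ φ
  have f3 : X₂ φ = 0 := by rw [← hφ₂]; exact ap hX₂ φ
  have f4 : Z₂ φ = 0 := by rw [← hφ₂]; exact ap hZ₂ φ
  -- Commutation keeps `X₂ θ` and `Z₂ θ` in the kernel of `P₁`, which removes the mixed terms.
  have g1 : P₁ (X₂ θ) = 0 := (ap hPX θ).trans (by simp [hθ₁])
  have g2 : P₁ (Z₂ θ) = 0 := (ap hPZ θ).trans (by simp [hθ₁])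
  simp only [add_apply, sub_apply, smul_apply, mul_apply_eq_comp, map_add, map_sub, map_smul,
    f1, f2, f3, f4, g1, g2, hφ₁, hφ₂, hθ₂, hXX, hZZ, smul_zero, add_zero, zero_add,
    sub_zero]
  module

/-- Normalizing moves `χ` by `|‖χ‖ - 1|`, at most `‖ψ - χ‖` since `ψ` is a unit vector. -/
theorem norm_inv_smul_sub_le {ψ χ : H} (hψ : ‖ψ‖ = 1) (hχ : χ ≠ 0) :
    ‖ψ - ((‖χ‖⁻¹ : ℝ) : ℂ) • χ‖ ≤ 2 * ‖ψ - χ‖ := by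
  have hχ' : ‖χ‖ ≠ 0 := norm_ne_zero_iff.2 hχ
  have h1 : ‖χ - ((‖χ‖⁻¹ : ℝ) : ℂ) • χ‖ = |‖χ‖ - ‖ψ‖| := by
    have : χ - ((‖χ‖⁻¹ : ℝ) : ℂ) • χ = ((1 - ‖χ‖⁻¹ : ℝ) : ℂ) • χ := by push_cast; module
    rw [this, norm_smul, Complex.norm_real, Real.norm_eq_abs, hψ, ← abs_norm χ, ← abs_mul,
      abs_norm, sub_mul, one_mul, inv_mul_cancel₀ hχ']
  have h2 := norm_sub_le_norm_sub_add_norm_sub ψ χ (((‖χ‖⁻¹ : ℝ) : ℂ) • χ)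
  have h3 := abs_norm_sub_norm_le χ ψ
  rw [norm_sub_rev χ ψ] at h3
  linarith

/-- If `T` acts on orthogonal vectors `φ` and `θ ≠ 0` by `2` and by `r > 2`, then its expectation in
the normalization of `φ + θ` exceeds `2`. -/
theorem two_lt_expectation {T : H →L[ℂ] H} {φ θ : H} {r : ℝ} (hr : 2 < r) (hθ : θ ≠ 0)
    (horth : ⟪φ, θ⟫_ℂ = 0) (hT : T (φ + θ) = (2 : ℂ) • φ + (r : ℂ) • θ) :
    2 < ‖⟪((‖φ + θ‖⁻¹ : ℝ) : ℂ) • (φ + θ), T (((‖φ + θ‖⁻¹ : ℝ) : ℂ) • (φ + θ))⟫_ℂ‖ := by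
  have horth' : ⟪θ, φ⟫_ℂ = 0 := inner_eq_zero_symm.1 horth
  have hθ' : 0 < ‖θ‖ := norm_pos_iff.2 hθ
  have hn : ‖φ + θ‖ * ‖φ + θ‖ = ‖φ‖ * ‖φ‖ + ‖θ‖ * ‖θ‖ :=
    norm_add_sq_eq_norm_sq_add_norm_sq_of_inner_eq_zero φ θ horth
  have hpos : 0 < ‖φ + θ‖ * ‖φ + θ‖ := by rw [hn]; positivity
  have hval : ⟪((‖φ + θ‖⁻¹ : ℝ) : ℂ) • (φ + θ), T (((‖φ + θ‖⁻¹ : ℝ) : ℂ) • (φ + θ))⟫_ℂ =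
      (((‖φ + θ‖ * ‖φ + θ‖)⁻¹ * (2 * (‖φ‖ * ‖φ‖) + r * (‖θ‖ * ‖θ‖)) : ℝ) : ℂ) := by
    rw [map_smul, hT, inner_smul_left, inner_smul_right, inner_add_left, inner_add_right,
      inner_add_right]
    simp only [inner_smul_right, horth, horth', inner_self_eq_norm_sq_to_K, Complex.conj_ofReal]
    push_cast
    simp only [Complex.coe_algebraMap, mul_inv]
    ring
  rw [hval, Complex.norm_real, Real.norm_of_nonneg (by positivity), inv_mul_eq_div,
    lt_div_iff₀ hpos, hn]
  nlinarith [mul_pos hθ' hθ']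

/-! ### Reflections, isometries and small supports -/

variable [CompleteSpace H]

theorem le_one_of_sq_eq_one {A : H →L[ℂ] H} (hA : IsSelfAdjoint A) (h : A * A = 1) : A ≤ 1 := by
  -- For a reflection, `(1 - A) / 2` is a projection.
  have h1 : 1 - A = (1 / 2 : ℝ) • (star (1 - A) * (1 - A)) := by
    have h2 : star (1 - A) * (1 - A) = (2 : ℝ) • (1 - A) := by
      rw [star_sub, star_one, hA.star_eq, two_smul, mul_sub, sub_mul, sub_mul, h]
      simp only [mul_one, one_mul]
      abel
    rw [h2, smul_smul]
    norm_num
  rw [← sub_nonneg, h1]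
  exact smul_nonneg (by norm_num) (star_mul_self_nonneg _)

theorem isSelfAdjointContraction_of_sq_eq_one {A : H →L[ℂ] H} (hA : IsSelfAdjoint A)
    (h : A * A = 1) : IsSelfAdjointContraction A :=
  ⟨hA, neg_le.1 (le_one_of_sq_eq_one hA.neg (by rw [neg_mul_neg, h])),
    le_one_of_sq_eq_one hA h⟩

theorem norm_apply_of_isometry {v : H →L[ℂ] H} (hv : star v * v = 1) (x : H) : ‖v x‖ = ‖x‖ := by
  rw [ContinuousLinearMap.star_eq_adjoint] at hv
  exact (v.norm_map_iff_adjoint_comp_self).2 hv x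

theorem norm_sub_isometry_sq {w : H →L[ℂ] H} (hw : star w * w = 1) (y : H) :
    ‖y - w (star w y)‖ ^ 2 = ‖y‖ ^ 2 - ‖star w y‖ ^ 2 := by
  have h1 : (⟪y, w (star w y)⟫_ℂ).re = ‖star w y‖ ^ 2 := by
    rw [← ContinuousLinearMap.adjoint_inner_left, ← ContinuousLinearMap.star_eq_adjoint,
      inner_self_eq_norm_sq_to_K]
    norm_cast
  have h2 := @norm_sub_sq ℂ H _ _ _ y (w (star w y))
  rw [RCLike.re_to_complex, h1, norm_apply_of_isometry hw] at h2
  rw [h2]; ring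

/-- In a properly infinite von Neumann algebra there are nonzero square-zero partial isometries
whose support is almost orthogonal to a given vector. -/
theorem ProperlyInfinite.exists_sq_zero {N : VonNeumannAlgebra H} [Nontrivial H]
    (hN : N.ProperlyInfinite) (ψ : H) {ε : ℝ} (hε : 0 < ε) :
    ∃ V ∈ N, V * V = 0 ∧ V * star V * V = V ∧ V ≠ 0 ∧
      ‖(star V * V + V * star V) ψ‖ < ε := by
  have hfin := hN 1 (one_mem N) (one_mem N.commutant) (.one _) one_ne_zero
  simp only [IsFiniteProj, MvNEquiv] at hfin
  push Not at hfin
  obtain ⟨q, -, -, -, ⟨v, hvN, hv, rfl⟩, hq⟩ := hfin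
  let a : ℕ → ℝ := fun n => ‖star (v ^ n) ψ‖ ^ 2
  have hvv : star (v * v) * (v * v) = 1 := by
    rw [star_mul, mul_assoc, ← mul_assoc (star v) v, hv, one_mul, hv]
  have hpow : ∀ n, star (v ^ n) * v ^ n = 1 := fun n => by
    induction n with
    | zero => simp
    | succ k ih =>
      rw [pow_succ', star_mul, mul_assoc, ← mul_assoc (star v), hv, one_mul, ih]
  have hstep : ∀ n, ‖star (v ^ n) ψ - (v * v) (star (v * v) (star (v ^ n) ψ))‖ ^ 2
      = a n - a (n + 2) := fun n => by
    rw [norm_sub_isometry_sq hvv, ← mul_apply_eq_comp, ← star_mul, ← mul_assoc,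
      ← pow_succ, ← pow_succ]
  have hanti : Antitone a := antitone_nat_of_succ_le fun n => by
    have h := norm_sub_isometry_sq hv (star (v ^ n) ψ)
    rw [← mul_apply_eq_comp (star v), ← star_mul, ← pow_succ] at h
    have := sq_nonneg ‖star (v ^ n) ψ - v ((star (v ^ (n + 1))) ψ)‖
    simp only [a]; linarith
  have hlim := tendsto_atTop_ciInf hanti ⟨0, by rintro _ ⟨n, rfl⟩; positivity⟩
  -- The support is `vⁿv*ⁿ - vⁿ⁺²v*ⁿ⁺²`, hence the gap of 2; the convergent sequence `a` makes it
  -- vanish on `ψ`.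
  have hdiff : Filter.Tendsto (fun n => a n - a (n + 2)) Filter.atTop (nhds 0) := by
    simpa using hlim.sub (hlim.comp (Filter.tendsto_add_atTop_nat 2))
  obtain ⟨n, hn⟩ := (hdiff.eventually_lt_const (pow_pos hε 2)).exists
  obtain ⟨h0, h1, h2, h3⟩ := exists_sq_zero_of_isometry hv hq n
  refine ⟨_, ?_, h0, h1, h2, ?_⟩
  · have := pow_mem hvN n
    exact mul_mem (mul_mem this (mul_mem hvN (sub_mem (one_mem N) (mul_mem hvN (star_mem hvN)))))
      (star_mem this)
  · rw [h3]
    simp only [mul_apply_eq_comp]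
    rw [norm_apply_of_isometry (hpow n)]
    simp only [sub_apply, one_apply_eq_self,
      mul_apply_eq_comp _ (star (v * v))]
    exact lt_of_pow_lt_pow_left₀ 2 hε.le (by rw [hstep]; exact hn)

/-- The reflections built from a square-zero partial isometry are self-adjoint contractions. -/
theorem isSelfAdjointContraction_pauli {V : H →L[ℂ] H} (h0 : V * V = 0)
    (h1 : V * star V * V = V) {a b : ℝ} (hab : a * a + b * b = 1) :
    IsSelfAdjointContraction (1 - (star V * V + V * star V) +
      ((a : ℂ) • (V + star V) + (b : ℂ) • (star V * V - V * star V))) := by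
  obtain ⟨hPP, hPX, hXP, hPZ, hZP, hXX, hZZ, hXZ⟩ := pauli_relations h0 h1
  have hP : star (1 - (star V * V + V * star V)) = 1 - (star V * V + V * star V) := by simp
  have hX : star (V + star V) = V + star V := by simp [add_comm]
  have hZ : star (star V * V - V * star V) = star V * V - V * star V := by simp
  generalize 1 - (star V * V + V * star V) = P at *
  generalize V + star V = X at *
  generalize star V * V - V * star V = Z at *
  refine isSelfAdjointContraction_of_sq_eq_one ?_ ?_
  · rw [isSelfAdjoint_iff, star_add, star_add, star_smul, star_smul, hP, hX, hZ]
    simp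
  · have hab' : (a : ℂ) * a + b * b = 1 := by exact_mod_cast hab
    have hZX : Z * X = -(X * Z) := eq_neg_of_add_eq_zero_right hXZ
    simp only [mul_add, add_mul, smul_mul_assoc, mul_smul_comm, hPP, hPX, hXP, hPZ, hZP, hXX, hZZ,
      hZX, smul_zero]
    linear_combination (norm := module) hab' • (1 - P)

/-- The entangled vector attached to a pair of commuting square-zero partial isometries. -/
theorem exists_entangled {V W : H →L[ℂ] H} (hV0 : V * V = 0) (hV1 : V * star V * V = V)
    (hW0 : W * W = 0) (hW1 : W * star W * W = W) (hVW : V * W = W * V)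
    (hVW' : V * star W = star W * V) (hne : star V * V * (star W * W) ≠ 0) :
    ∃ θ : H, ‖θ‖ = 1 ∧ (star V * V + V * star V) θ = θ ∧ (star W * W + W * star W) θ = θ ∧
      (V + star V) ((W + star W) θ) = θ ∧
      (star V * V - V * star V) ((star W * W - W * star W) θ) = θ := by
  obtain ⟨x, hx⟩ : ∃ x, (star V * V * (star W * W)) x ≠ 0 := by
    by_contra! h
    exact hne (ContinuousLinearMap.ext h)
  have hV1s : star V * V * star V = star V := by simpa [mul_assoc] using congrArg star hV1
  have hW1s : star W * W * star W = star W := by simpa [mul_assoc] using congrArg star hW1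
  have hV0s : star V * star V = 0 := by simpa using congrArg star hV0
  have hW0s : star W * star W = 0 := by simpa using congrArg star hW0
  have hVWs : star V * star W = star W * star V := by simpa using congrArg star hVW.symm
  have hVWs' : star V * W = W * star V := by simpa using congrArg star hVW'.symm
  set ξ := (star V * V * (star W * W)) x with hξ
  clear_value ξ
  have ap : ∀ {S T : H →L[ℂ] H}, S = T → ∀ y, S y = T y := fun h y => by rw [h]
  have c1 : ∀ y, V (W y) = W (V y) := ap hVW
  have c2 : ∀ y, V (star W y) = star W (V y) := ap hVW'
  have c3 : ∀ y, star V (star W y) = star W (star V y) := ap hVWs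
  have c4 : ∀ y, star V (W y) = W (star V y) := ap hVWs'
  have z1 : ∀ y, V (V y) = 0 := ap hV0
  have z2 : ∀ y, star V (star V y) = 0 := ap hV0s
  have z3 : ∀ y, W (W y) = 0 := ap hW0
  have z4 : ∀ y, star W (star W y) = 0 := ap hW0s
  have p1 : ∀ y, star V (V (star V y)) = star V y := ap hV1s
  have p2 : ∀ y, star W (W (star W y)) = star W y := ap hW1s
  have hξ' : ξ = star W (W (star V (V x))) := by
    rw [hξ]; simp only [mul_apply_eq_comp, c1, c2, c3, c4]
  have e1 : star V (V ξ) = ξ := by rw [hξ']; simp only [c1, c2, c3, c4, p1]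
  have e2 : star V ξ = 0 := by rw [hξ']; simp only [c3, c4, z2, map_zero]
  have e3 : star W (W ξ) = ξ := by rw [hξ', p2]
  have e4 : star W ξ = 0 := by rw [hξ', z4]
  have e5 : star W (W (V ξ)) = V ξ := by rw [← c1, ← c2, e3]
  -- `star V * V` fixes `ξ` and kills `W (V ξ)`, as `V * V = 0`.
  have hη : ξ + W (V ξ) ≠ 0 := by
    intro h
    have h' := congrArg (fun y => star V (V y)) h
    simp only [map_add, c1, z1, e1, map_zero, add_zero] at h'
    exact hx h'
  have key : (star V * V + V * star V) (ξ + W (V ξ)) = ξ + W (V ξ) ∧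
      (star W * W + W * star W) (ξ + W (V ξ)) = ξ + W (V ξ) ∧
      (V + star V) ((W + star W) (ξ + W (V ξ))) = ξ + W (V ξ) ∧
      (star V * V - V * star V) ((star W * W - W * star W) (ξ + W (V ξ))) = ξ + W (V ξ) := by
    refine ⟨?_, ?_, ?_, ?_⟩ <;>
    simp [c1, c4, z1, z3, e1, e2, e3, e4, e5, add_comm]
  refine ⟨((‖ξ + W (V ξ)‖⁻¹ : ℝ) : ℂ) • (ξ + W (V ξ)), ?_, ?_⟩
  · rw [norm_smul, Complex.norm_real, norm_inv, norm_norm, inv_mul_cancel₀ (norm_ne_zero_iff.2 hη)]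
  · obtain ⟨k1, k2, k3, k4⟩ := key
    refine ⟨?_, ?_, ?_, ?_⟩ <;> simp only [map_smul, k1, k2, k3, k4]

/-- A projection of the form `1 - (V* V + V V*)` does not increase norms. -/
theorem norm_one_sub_support_apply_le {V : H →L[ℂ] H} (h0 : V * V = 0)
    (h1 : V * star V * V = V) (x : H) : ‖(1 - (star V * V + V * star V)) x‖ ≤ ‖x‖ := by
  have hp : IsStarProjection (1 - (star V * V + V * star V)) :=
    ⟨(pauli_relations h0 h1).1, by simp [isSelfAdjoint_iff]⟩
  simpa using (1 - (star V * V + V * star V)).le_of_opNorm_le hp.norm_le x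

end VonNeumannAlgebra

/-! ### Assembly of the perturbed vector -/

theorem corollary2 {H : Type*} [NormedAddCommGroup H] [InnerProductSpace ℂ H] [CompleteSpace H]
    (N₁ N₂ : VonNeumannAlgebra H)
    (h₁ : N₁.ProperlyInfinite) (h₂ : N₂.ProperlyInfinite)
    (hcomm : N₁ ≤ N₂.commutant)
    (hprod : ∀ X₁ ∈ N₁, ∀ X₂ ∈ N₂, X₁ ≠ 0 → X₂ ≠ 0 → X₁ * X₂ ≠ 0)
    (Ψ : H) (hΨ : ‖Ψ‖ = 1) (ε : ℝ) (hε : 0 < ε) :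
    ∃ (Ψ' : H) (hΨ' : ‖Ψ'‖ = 1), ‖Ψ - Ψ'‖ < ε ∧
      VonNeumannAlgebra.BellCorrelated N₁ N₂ ((N₁.join N₂).vectorState Ψ' hΨ') := by
  have : Nontrivial H := ⟨Ψ, 0, by rintro rfl; simp at hΨ⟩
  -- Two supports and `θ'` cost `ε / 8` each, below `ε / 2` in all; normalizing at most doubles
  -- this.
  obtain ⟨V, hV, hV0, hV1, hVne, hVs⟩ := h₁.exists_sq_zero Ψ (ε := ε / 8) (by positivity)
  obtain ⟨W, hW, hW0, hW1, hWne, hWs⟩ := h₂.exists_sq_zero Ψ (ε := ε / 8) (by positivity)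
  have comm : ∀ {x y}, x ∈ N₁ → y ∈ N₂ → x * y = y * x := fun hx hy =>
    (VonNeumannAlgebra.mem_commutant_iff.1 (hcomm hx) _ hy).symm
  have hV' := star_mem hV
  have hW' := star_mem hW
  have hne : star V * V * (star W * W) ≠ 0 := by
    refine hprod _ (mul_mem hV' hV) _ (mul_mem hW' hW) ?_ ?_
    · intro h; apply hVne; rw [← hV1, mul_assoc, h, mul_zero]
    · intro h; apply hWne; rw [← hW1, mul_assoc, h, mul_zero]
  obtain ⟨θ, hθn, hθ₁, hθ₂, hXXθ, hZZθ⟩ := VonNeumannAlgebra.exists_entangled hV0 hV1 hW0 hW1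
    (comm hV hW) (comm hV hW') hne
  obtain ⟨hP₁, hPX₁, hXP₁, hPZ₁, hZP₁, -⟩ := VonNeumannAlgebra.pauli_relations hV0 hV1
  obtain ⟨hP₂, hPX₂, hXP₂, hPZ₂, hZP₂, -⟩ := VonNeumannAlgebra.pauli_relations hW0 hW1
  have hA₁ := VonNeumannAlgebra.isSelfAdjointContraction_pauli hV0 hV1 (a := 1) (b := 0) (by simp)
  have hB₁ := VonNeumannAlgebra.isSelfAdjointContraction_pauli hV0 hV1 (a := 0) (b := 1) (by simp)
  have hc : √2 / 2 * (√2 / 2) = (1 / 2 : ℝ) := by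
    have := Real.mul_self_sqrt (show (0 : ℝ) ≤ 2 by norm_num); linarith
  -- The directions `(X₂ ± Z₂) / √2` are the optimal CHSH settings against `X₁`, `Z₁`.
  have hA₂ := VonNeumannAlgebra.isSelfAdjointContraction_pauli hW0 hW1 (a := √2 / 2) (b := √2 / 2)
    (by linarith)
  have hB₂ := VonNeumannAlgebra.isSelfAdjointContraction_pauli hW0 hW1 (a := √2 / 2)
    (b := -(√2 / 2)) (by linarith)
  have hPΨ := VonNeumannAlgebra.norm_one_sub_support_apply_le hV0 hV1
    ((star W * W + W * star W) Ψ)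
  have hP₁mem : 1 - (star V * V + V * star V) ∈ N₁ :=
    sub_mem (one_mem N₁) (add_mem (mul_mem hV' hV) (mul_mem hV hV'))
  have hX₁mem : V + star V ∈ N₁ := add_mem hV hV'
  have hZ₁mem : star V * V - V * star V ∈ N₁ := sub_mem (mul_mem hV' hV) (mul_mem hV hV')
  have hP₂mem : 1 - (star W * W + W * star W) ∈ N₂ :=
    sub_mem (one_mem N₂) (add_mem (mul_mem hW' hW) (mul_mem hW hW'))
  have hX₂mem : W + star W ∈ N₂ := add_mem hW hW'
  have hZ₂mem : star W * W - W * star W ∈ N₂ := sub_mem (mul_mem hW' hW) (mul_mem hW hW')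
  have hP₁sa : star (1 - (star V * V + V * star V)) = 1 - (star V * V + V * star V) := by simp
  set s₁ := star V * V + V * star V
  set s₂ := star W * W + W * star W
  set X₁ := V + star V
  set X₂ := W + star W
  set Z₁ := star V * V - V * star V
  set Z₂ := star W * W - W * star W
  set P₁ := 1 - s₁ with hP₁def
  set P₂ := 1 - s₂ with hP₂def
  let φ : H := P₁ (P₂ Ψ)
  let θ' : H := ((ε / 8 : ℝ) : ℂ) • θ
  have hθ'n : ‖θ'‖ = ε / 8 := by
    rw [norm_smul, hθn, Complex.norm_real, Real.norm_of_nonneg (by positivity), mul_one]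
  have hθ' : θ' ≠ 0 := norm_ne_zero_iff.1 (by rw [hθ'n]; positivity)
  have hPθ₁ : P₁ θ' = 0 := by simp [θ', P₁, hθ₁]
  have hPθ₂ : P₂ θ' = 0 := by simp [θ', P₂, hθ₂]
  have hφ₁ : P₁ φ = φ := by
    change (P₁ * P₁) (P₂ Ψ) = _
    rw [hP₁]
  have hφ₂ : P₂ φ = φ := by
    change (P₂ * P₁) (P₂ Ψ) = _
    rw [← comm hP₁mem hP₂mem]
    change P₁ ((P₂ * P₂) Ψ) = _
    rw [hP₂]
  have horth : ⟪φ, θ'⟫_ℂ = 0 := by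
    rw [← hφ₁, ← ContinuousLinearMap.adjoint_inner_right, ← ContinuousLinearMap.star_eq_adjoint,
      hP₁sa, hPθ₁, inner_zero_right]
  have hχ : φ + θ' ≠ 0 := by
    intro h
    have h' := congrArg P₁ h
    rw [map_add, hφ₁, hPθ₁, map_zero, add_zero] at h'
    rw [h', zero_add] at h
    exact hθ' h
  have hdist : ‖Ψ - (φ + θ')‖ < ε / 2 := by
    have h : Ψ - (φ + θ') = s₁ Ψ + P₁ (s₂ Ψ) - θ' := by
      simp only [φ, P₁, P₂, sub_apply, one_apply_eq_self, map_sub]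
      abel
    rw [h]
    have h1 := norm_sub_le (s₁ Ψ + P₁ (s₂ Ψ)) θ'
    have h2 := norm_add_le (s₁ Ψ) (P₁ (s₂ Ψ))
    linarith
  have hr : 2 < 4 * (√2 / 2) := by
    have : 1 < √2 := Real.lt_sqrt_of_sq_lt (by norm_num)
    linarith
  have hT := VonNeumannAlgebra.chsh_apply (φ := φ) (θ := θ') ((√2 / 2 : ℝ) : ℂ) hφ₁ hφ₂ hPθ₁ hPθ₂
    hXP₁ hZP₁ hXP₂ hZP₂ (comm hP₁mem hX₂mem) (comm hP₁mem hZ₂mem)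
    (by simp only [θ', map_smul, hXXθ]) (by simp only [θ', map_smul, hZZθ])
  have hbell := VonNeumannAlgebra.two_lt_expectation hr hθ' horth
    (hT.trans (by push_cast; rfl))
  refine ⟨((‖φ + θ'‖⁻¹ : ℝ) : ℂ) • (φ + θ'), ?_,
    (VonNeumannAlgebra.norm_inv_smul_sub_le hΨ hχ).trans_lt (by linarith),
    ⟨P₁ + X₁, add_mem hP₁mem hX₁mem⟩, ⟨P₁ + Z₁, add_mem hP₁mem hZ₁mem⟩,
    ⟨P₂ + ((√2 / 2 : ℝ) : ℂ) • (X₂ + Z₂),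
      add_mem hP₂mem (N₂.toStarSubalgebra.smul_mem (add_mem hX₂mem hZ₂mem) _)⟩,
    ⟨P₂ + ((√2 / 2 : ℝ) : ℂ) • (X₂ - Z₂),
      add_mem hP₂mem (N₂.toStarSubalgebra.smul_mem (sub_mem hX₂mem hZ₂mem) _)⟩, ?_, ?_, ?_, ?_, ?_⟩
  · rw [norm_smul, Complex.norm_real, norm_inv, norm_norm, inv_mul_cancel₀ (norm_ne_zero_iff.2 hχ)]
  · simpa using hA₁
  · simpa using hB₁
  · simpa only [smul_add] using hA₂
  · simpa only [smul_sub, Complex.ofReal_neg, neg_smul, ← sub_eq_add_neg] using hB₂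
  · have h : ∀ r : ℝ, 2 < r → 1 < (1 / 2 : ℝ) * r := fun r hr => by linarith
    exact h _ hbell
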